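/- Let $X$ be a separable metrizable space. The dimension of a subset of $X$ is its Lebesgue covering dimension in the subspace topology: a space has dimension $\le n$ if each of its open covers has an open refinement, again a cover, such that every point lies in at most $n+1$ members of the refinement; a set is finite-dimensional if its dimension is $\le n$ for some $n$ (the empty set, of dimension $-1$, included), and zero-dimensional if it is nonempty and of dimension $\le 0$. Let $\mathcal{O}$ be the collection of all open covers of $X$, and let $\mathcal{O}_{\mathsf{fd}}$ be the collection of those open covers $\mathcal{U}$ of $X$ such that $X\notin\mathcal{U}$ and every finite-dimensional subset of $X$ is contained in some member of $\mathcal{U}$. In the game $\mathsf{G}_1(\mathcal{O}_{\mathsf{fd}},\mathcal{O})$ players ONE and TWO play one inning for each positive integer $n$: in the $n$-th inning ONE first chooses $O_n\in\mathcal{O}_{\mathsf{fd}}$, and then TWO chooses $T_n\in O_n$. TWO wins the play if $\{T_n : n\in\mathbb{N}\}\in\mathcal{O}$, and otherwise ONE wins. Then the following are equivalent: 1. $X$ is countable dimensional, that is, $X$ is the union of a countable (possibly empty or finite) family of zero-dimensional subsets. 2. TWO has a winning strategy in $\mathsf{G}_1(\mathcal{O}_{\mathsf{fd}},\mathcal{O})$.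 -/

import Mathlib

namespace DimGame

/-- `𝒰` is an open cover of the space `X`. -/
def IsOpenCover {X : Type*} [TopologicalSpace X] (𝒰 : Set (Set X)) : Prop :=
  (∀ U ∈ 𝒰, IsOpen U) ∧ ⋃₀ 𝒰 = Set.univ

/-- The Lebesgue covering dimension of `X` is at most `n`: every open cover of `X` has an open
refinement covering `X` such that every point lies in at most `n + 1` of its members. -/
def CoveringDimLE (X : Type*) [TopologicalSpace X] (n : ℕ) : Prop :=
  ∀ 𝒰 : Set (Set X), IsOpenCover 𝒰 →
    ∃ 𝒱 : Set (Set X), IsOpenCover 𝒱 ∧ (∀ V ∈ 𝒱, ∃ U ∈ 𝒰, V ⊆ U) ∧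
      ∀ x : X, {V | V ∈ 𝒱 ∧ x ∈ V}.encard ≤ (n : ℕ∞) + 1

/-- A subset, with the subspace topology, has finite covering dimension.
The empty set (of dimension `-1`) is finite dimensional. -/
def IsFiniteDim {X : Type*} [TopologicalSpace X] (A : Set X) : Prop :=
  ∃ n : ℕ, CoveringDimLE A n

/-- A subset, with the subspace topology, has covering dimension exactly `0`. -/
def IsZeroDim {X : Type*} [TopologicalSpace X] (A : Set X) : Prop :=
  A.Nonempty ∧ CoveringDimLE A 0

/-- `X` is a union of countably many zero-dimensional subsets. -/
def IsCountableDim (X : Type*) [TopologicalSpace X] : Prop :=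
  ∃ 𝒮 : Set (Set X), 𝒮.Countable ∧ (∀ A ∈ 𝒮, IsZeroDim A) ∧ ⋃₀ 𝒮 = Set.univ

/-- The collection `𝒪` of all open covers of `X`. -/
def openCovers (X : Type*) [TopologicalSpace X] : Set (Set (Set X)) :=
  {𝒰 | IsOpenCover 𝒰}

/-- The collection `𝒪(𝒯)` of `𝒯`-covers: open covers `𝒰` of `X` such that `X ∉ 𝒰` and each
`T ∈ 𝒯` is contained in some member of `𝒰`. -/
def tCovers {X : Type*} [TopologicalSpace X] (𝒯 : Set (Set X)) : Set (Set (Set X)) :=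
  {𝒰 | IsOpenCover 𝒰 ∧ Set.univ ∉ 𝒰 ∧ ∀ T ∈ 𝒯, ∃ U ∈ 𝒰, T ⊆ U}

/-- The collection `𝒪_fd` of covers by open sets relative to the family of all finite dimensional
subsets of `X`. -/
def fdCovers (X : Type*) [TopologicalSpace X] : Set (Set (Set X)) :=
  tCovers {T : Set X | IsFiniteDim T}

/-- The move that the strategy `F` of TWO prescribes in inning `n` (counted from `0`) against
ONE's moves `O 0, O 1, …`: it depends only on `O 0, …, O n`. -/
def response {α : Type*} (F : List (Set α) → α) (O : ℕ → Set α) (n : ℕ) : α :=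
  F ((List.range (n + 1)).map O)

/-- TWO has a winning strategy in the game `G₁(𝒜, ℬ)`: in inning `n` ONE chooses `O n ∈ 𝒜` and
TWO responds with an element of `O n`; TWO wins if the set of TWO's choices belongs to `ℬ`. -/
def TwoHasWinningStrategy {α : Type*} (𝒜 ℬ : Set (Set α)) : Prop :=
  ∃ F : List (Set α) → α, ∀ O : ℕ → Set α, (∀ n, O n ∈ 𝒜) →
    (∀ n, response F O n ∈ O n) ∧ Set.range (response F O) ∈ ℬ

end DimGame

/-! If `X` is covered by zero-dimensional sets `A n`, TWO answers in inning `n` with a member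
containing `A n`. For the converse, `exists_finiteDim_of_legal` attaches to each position a
finite-dimensional `T` such that TWO can be forced to play any open `U ≠ X` around `T`. By
`IsFiniteDim.exists_countablyZeroDim_superset`, `T` lies in a `Gδ` set that is a countable union of
sets of dimension `≤ 0`. Forcing only the countably many open sets defining it leaves a countable
tree of positions. A point outside all the `Gδ` sets could be avoided in every inning, so these sets
cover `X`.

The `Gδ` enlargement comes from perturbing functions that separate small balls from complements of
larger ones: general position and Baire category leave no `n + 1` of them with a common zero on `T`.
-/

open Topology Filter Set
open scoped BoundedContinuousFunction

namespace DimGame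

/-! ### General position and perturbation in dimension `≤ n`. -/

/-- Finitely many points can be moved slightly into general position. -/
lemma exists_generalPosition {J : Type*} [Fintype J] {N : ℕ} (hJ : N ≤ Fintype.card J)
    (c : J → Fin N → ℝ) {η : ℝ} (hη : 0 < η) :
    ∃ p : J → Fin N → ℝ, (∀ j, dist (p j) (c j) < η) ∧
      ∀ w : J → ℝ, (Finset.univ.filter fun j => w j ≠ 0).card ≤ N →
        ∑ j, w j • p j = 0 → w = 0 := by
  classical
  let e : J → ℝ := fun j => (Fintype.equivFin J j : ℕ)
  have he : Function.Injective e := by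
    intro i j h
    simpa [e, Fin.val_inj] using h
  -- Moving along the moment curve makes each `N × N` determinant a polynomial in `s` whose
  -- coefficient of degree `N` is a nonzero Vandermonde determinant.
  let p : ℝ → J → Fin N → ℝ := fun s j => c j + s • (fun k => e j ^ (k : ℕ) : Fin N → ℝ)
  have hclose : ∀ j, ∀ᶠ s in 𝓝[≠] (0 : ℝ), dist (p s j) (c j) < η := by
    intro j
    have hc : Continuous fun s : ℝ => dist (p s j) (c j) := by
      dsimp only [p]; fun_prop
    have h0 : dist (p 0 j) (c j) < η := by simpa [p] using hη
    exact (hc.continuousAt.eventually_lt continuousAt_const h0).filter_mono nhdsWithin_le_nhds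
  have hdet : ∀ b : Fin N ↪ J, ∀ᶠ s in 𝓝[≠] (0 : ℝ),
      (Matrix.of fun i => p s (b i)).det ≠ 0 := by
    intro b
    let A : Matrix (Fin N) (Fin N) ℝ := Matrix.vandermonde (e ∘ b)
    let B : Matrix (Fin N) (Fin N) ℝ := Matrix.of fun i => c (b i)
    let q : Polynomial ℝ := (((Polynomial.X : Polynomial ℝ) • A.map Polynomial.C +
      B.map Polynomial.C : Matrix (Fin N) (Fin N) (Polynomial ℝ))).det
    have hq : q ≠ 0 := by
      intro h
      have := Polynomial.coeff_det_X_add_C_card A B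
      rw [show (((Polynomial.X : Polynomial ℝ) • A.map Polynomial.C +
        B.map Polynomial.C : Matrix (Fin N) (Fin N) (Polynomial ℝ))).det = 0 from h] at this
      exact Matrix.det_vandermonde_ne_zero_iff.2 (he.comp b.injective) (by simpa using this.symm)
    have hev : ∀ s, q.eval s = (Matrix.of fun i => p s (b i)).det := by
      intro s
      rw [← Polynomial.coe_evalRingHom, RingHom.map_det]
      congr 1
      ext i k
      simp [A, B, p, Matrix.vandermonde_apply, add_comm]
    have hfin : {s | q.eval s = 0}.Finite := by
      refine q.roots.toFinset.finite_toSet.subset fun s hs => ?_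
      simpa [hq] using hs
    have h2 : ({s | q.eval s = 0} \ {0}).Finite := hfin.subset sdiff_subset
    have h3 : ({s | q.eval s = 0} \ {0})ᶜ ∈ 𝓝 (0 : ℝ) :=
      h2.isClosed.isOpen_compl.mem_nhds (by simp)
    filter_upwards [nhdsWithin_le_nhds h3, self_mem_nhdsWithin] with s hs hs0
    rw [← hev]
    intro h
    exact hs ⟨h, hs0⟩
  obtain ⟨s, hs1, hs2⟩ := ((eventually_all.2 hclose).and (eventually_all.2 hdet)).exists
  refine ⟨p s, hs1, fun w hw hsum => ?_⟩
  obtain ⟨S, hS, hcard⟩ := Finset.exists_superset_card_eq hw hJ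
  let b : Fin N ↪ J := (S.equivFinOfCardEq hcard).symm.toEmbedding.trans (Function.Embedding.subtype _)
  have hw0 : ∀ j, j ∉ S → w j = 0 := by
    intro j hj
    by_contra h
    exact hj (hS (by simp [h]))
  have hv : Matrix.vecMul (fun i => w (b i)) (Matrix.of fun i => p s (b i)) = 0 := by
    rw [← hsum, Matrix.vecMul_eq_sum]
    rw [← Finset.sum_subset (Finset.subset_univ S) fun j _ hj => by simp [hw0 j hj],
      ← Finset.sum_coe_sort S]
    exact Fintype.sum_equiv (S.equivFinOfCardEq hcard).symm _ _ fun i => rfl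
  have hz := Matrix.eq_zero_of_vecMul_eq_zero (hs2 b) hv
  ext j
  by_cases hj : j ∈ S
  · have := congrFun hz (S.equivFinOfCardEq hcard ⟨j, hj⟩)
    simpa [b] using this
  · exact hw0 j hj

/-- A finite open cover shrinks to one of order at most `n + 1`, indexed by the same set. -/
lemma CoveringDimLE.exists_shrinking {Y J : Type*} [TopologicalSpace Y] [Finite J] {n : ℕ}
    (hY : CoveringDimLE Y n) (W : J → Set Y) (hW : ∀ j, IsOpen (W j)) (hc : ⋃ j, W j = univ) :
    ∃ V : J → Set Y, (∀ j, IsOpen (V j)) ∧ (∀ j, V j ⊆ W j) ∧ ⋃ j, V j = univ ∧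
      ∀ y, {j | y ∈ V j}.encard ≤ n + 1 := by
  obtain ⟨𝒱, ⟨hVo, hVc⟩, hVr, hVn⟩ := hY (range W) ⟨by rintro _ ⟨j, rfl⟩; exact hW j, by
    simpa [sUnion_range] using hc⟩
  have : ∀ V : 𝒱, ∃ j, (V : Set Y) ⊆ W j := fun V => by
    obtain ⟨_, ⟨j, rfl⟩, h⟩ := hVr V V.2
    exact ⟨j, h⟩
  choose a ha using this
  refine ⟨fun j => ⋃ V : 𝒱, ⋃ _ : a V = j, (V : Set Y),
    fun j => isOpen_iUnion fun V => isOpen_iUnion fun _ => hVo V V.2, ?_, ?_, fun y => ?_⟩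
  · intro j
    exact iUnion_subset fun V => iUnion_subset fun h => h ▸ ha V
  · refine eq_univ_of_forall fun y => ?_
    obtain ⟨V, hV, hy⟩ := (hVc ▸ mem_univ y : y ∈ ⋃₀ 𝒱)
    exact mem_iUnion.2 ⟨a ⟨V, hV⟩, mem_iUnion.2 ⟨⟨V, hV⟩, mem_iUnion.2 ⟨rfl, hy⟩⟩⟩
  · refine le_trans ?_ (hVn y)
    have hsub : {j | y ∈ ⋃ V : 𝒱, ⋃ _ : a V = j, (V : Set Y)} ⊆
        a '' {V : 𝒱 | y ∈ (V : Set Y)} := by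
      intro j hj
      simp only [mem_ofPred_eq, mem_iUnion] at hj
      obtain ⟨V, h, hy⟩ := hj
      exact ⟨V, hy, h⟩
    refine (encard_le_encard hsub).trans ((encard_image_le _ _).trans ?_)
    rw [← Subtype.val_injective.encard_image]
    refine encard_le_encard ?_
    rintro _ ⟨V, hV, rfl⟩
    exact ⟨V.2, hV⟩

/-- A bounded map from a space of dimension `≤ n` to `ℝⁿ⁺¹` can be moved slightly so that it stays
uniformly away from the origin. -/
lemma CoveringDimLE.exists_perturbation {Y : Type*} [TopologicalSpace Y] [NormalSpace Y] {n : ℕ}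
    (hY : CoveringDimLE Y n) {h : Y → Fin (n + 1) → ℝ} (hh : Continuous h)
    (hb : Bornology.IsBounded (range h)) {δ : ℝ} (hδ : 0 < δ) :
    ∃ h' : Y → Fin (n + 1) → ℝ, Continuous h' ∧ (∀ y, dist (h' y) (h y) < δ) ∧
      ∃ ε > 0, ∀ y, ε ≤ ‖h' y‖ := by
  classical
  obtain ⟨t, ht, htc⟩ := Metric.totallyBounded_iff.1
    (hb.isCompact_closure.totallyBounded.subset subset_closure) (δ / 2) (half_pos hδ)
  have := ht.fintype
  -- The extra `n + 1` indices, centred at `0`, only make `J` large enough for general position.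
  let J := t ⊕ Fin (n + 1)
  let c : J → Fin (n + 1) → ℝ := Sum.elim Subtype.val 0
  obtain ⟨p, hp, hgp⟩ := exists_generalPosition (J := J) (N := n + 1)
    (by simp [J]) c (half_pos hδ)
  obtain ⟨V, hVo, hVW, hVc, hVn⟩ := hY.exists_shrinking
    (fun j => h ⁻¹' Metric.ball (c j) (δ / 2)) (fun j => Metric.isOpen_ball.preimage hh) (by
      refine eq_univ_of_forall fun y => ?_
      obtain ⟨x, hx, hy⟩ := mem_iUnion₂.1 (htc (mem_range_self y))
      exact mem_iUnion.2 ⟨Sum.inl ⟨x, hx⟩, hy⟩)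
  obtain ⟨f, hf⟩ := PartitionOfUnity.exists_isSubordinate_of_locallyFinite isClosed_univ V hVo
    (locallyFinite_of_finite V) hVc.ge
  have hsum : ∀ y, ∑ j, f j y = 1 := fun y => by
    rw [← finsum_eq_sum_of_fintype]; exact f.sum_eq_one (mem_univ y)
  have hmem : ∀ y j, f j y ≠ 0 → y ∈ V j := fun y j hj => hf j (subset_tsupport _ hj)
  have hcard : ∀ y, (Finset.univ.filter fun j => f j y ≠ 0).card ≤ n + 1 := by
    intro y
    have h1 : ((Finset.univ.filter fun j => f j y ≠ 0 : Finset J) : Set J).encard ≤ n + 1 :=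
      (encard_le_encard fun j hj => hmem y j (by simpa using hj)).trans (hVn y)
    rw [encard_coe_eq_coe_finsetCard] at h1
    exact_mod_cast h1
  refine ⟨fun y => ∑ j, f j y • p j, ?_, fun y => ?_, ?_⟩
  · exact continuous_finsetSum _ fun j _ => (f j).continuous.smul continuous_const
  · have h1 : (∑ j, f j y • p j) - h y = ∑ j, f j y • (p j - h y) := by
      simp only [smul_sub, Finset.sum_sub_distrib, ← Finset.sum_smul, hsum, one_smul]
    rw [dist_eq_norm, h1]
    have h2 : ∀ j, ‖f j y • (p j - h y)‖ ≤ f j y * δ ∧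
        (f j y ≠ 0 → ‖f j y • (p j - h y)‖ < f j y * δ) := by
      intro j
      have h3 : f j y ≠ 0 → ‖f j y • (p j - h y)‖ < f j y * δ := by
        intro hj
        have h4 : dist (h y) (c j) < δ / 2 := hVW j (hmem y j hj)
        have h5 : dist (p j) (h y) < δ := by
          have := dist_triangle_right (p j) (h y) (c j)
          have := hp j
          linarith
        rw [norm_smul, Real.norm_of_nonneg (f.nonneg j y), ← dist_eq_norm]
        exact mul_lt_mul_of_pos_left h5 (lt_of_le_of_ne (f.nonneg j y) (Ne.symm hj))
      refine ⟨?_, h3⟩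
      by_cases hj : f j y = 0
      · simp [hj]
      · exact (h3 hj).le
    obtain ⟨j₀, hj₀⟩ : ∃ j, f j y ≠ 0 := by
      by_contra! hcon
      have := hsum y
      simp [hcon] at this
    calc ‖∑ j, f j y • (p j - h y)‖ ≤ ∑ j, ‖f j y • (p j - h y)‖ := norm_sum_le _ _
      _ < ∑ j, f j y * δ := Finset.sum_lt_sum (fun j _ => (h2 j).1)
          ⟨j₀, Finset.mem_univ _, (h2 j₀).2 hj₀⟩
      _ = δ := by rw [← Finset.sum_mul, hsum, one_mul]
  -- `Λ` holds all weights with at most `n + 1` nonzero entries. Its compactness, not that of `Y`,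
  -- gives the uniform bound.
  · let Λ : Set (J → ℝ) := ⋃ S ∈ {S : Finset J | S.card ≤ n + 1},
      stdSimplex ℝ J ∩ {w | ∀ j ∉ S, w j = 0}
    have hΛ : IsCompact Λ := by
      refine (Set.toFinite _).isCompact_biUnion fun S _ => (isCompact_stdSimplex ℝ J).inter_right ?_
      simp only [ofPred_forall]
      exact isClosed_iInter fun j => isClosed_iInter fun _ =>
        isClosed_eq (continuous_apply j) continuous_const
    have hcont : Continuous fun w : J → ℝ => ‖∑ j, w j • p j‖ := by fun_prop
    have hpos : ∀ w ∈ Λ, 0 < ‖∑ j, w j • p j‖ := by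
      intro w hw
      obtain ⟨S, hS, hw1, hw2⟩ := mem_iUnion₂.1 hw
      refine norm_pos_iff.2 fun h0 => ?_
      have := hgp w ((Finset.card_le_card fun j hj => by
        by_contra hjS
        simp [hw2 j hjS] at hj).trans hS) h0
      have h1 := hw1.2
      simp [this] at h1
    have hmemΛ : ∀ y, (fun j => f j y) ∈ Λ := fun y => mem_iUnion₂.2
      ⟨Finset.univ.filter fun j => f j y ≠ 0, hcard y, ⟨fun j => f.nonneg j y, hsum y⟩,
        fun j hj => by simpa using hj⟩
    rcases Λ.eq_empty_or_nonempty with h0 | h0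
    · exact ⟨1, one_pos, fun y => absurd (hmemΛ y) (by simp [h0])⟩
    · obtain ⟨w, hw, hmin⟩ := hΛ.exists_isMinOn h0 hcont.continuousOn
      exact ⟨_, hpos w hw, fun y => hmin (hmemΛ y)⟩

/-- On a space of dimension `≤ n`, every countable family of uniformly bounded real functions can
be moved slightly so that no `n + 1` of them have a common zero. -/
lemma CoveringDimLE.exists_near_family {Y ι : Type*} [TopologicalSpace Y] [NormalSpace Y]
    [TopologicalSpace ι] [DiscreteTopology ι] [Countable ι] {n : ℕ} (hY : CoveringDimLE Y n)
    (g₀ : ι × Y →ᵇ ℝ) {r : ℝ} (hr : 0 < r) :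
    ∃ g : ι × Y →ᵇ ℝ, dist g g₀ < r ∧
      ∀ a : Fin (n + 1) ↪ ι, ∀ y, ∃ k, g (a k, y) ≠ 0 := by
  classical
  -- The uniform `ε`, stronger than having no common zero, makes `O a` open, so Baire's theorem
  -- applies.
  let O : (Fin (n + 1) ↪ ι) → Set (ι × Y →ᵇ ℝ) := fun a =>
    {g | ∃ ε > 0, ∀ y, ∃ k, ε ≤ |g (a k, y)|}
  have hO : ∀ a, IsOpen (O a) := by
    intro a
    refine Metric.isOpen_iff.2 fun g hg => ?_
    obtain ⟨ε, hε, h⟩ := hg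
    refine ⟨ε / 2, half_pos hε, fun g' hg' => ⟨ε / 2, half_pos hε, fun y => ?_⟩⟩
    obtain ⟨k, hk⟩ := h y
    refine ⟨k, ?_⟩
    have h1 := (BoundedContinuousFunction.dist_coe_le_dist (a k, y)).trans_lt hg'
    rw [Real.dist_eq, abs_sub_comm] at h1
    have := abs_sub_abs_le_abs_sub (g (a k, y)) (g' (a k, y))
    linarith
  have hd : ∀ a, Dense (O a) := by
    intro a
    refine Metric.dense_iff.2 fun g δ hδ => ?_
    have hcont : Continuous fun y => fun k => g (a k, y) := by fun_prop
    obtain ⟨h', hc', hclose, ε, hε, hfar⟩ := hY.exists_perturbation hcont (by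
      refine (Metric.isBounded_closedBall (x := 0) (r := ‖g‖)).subset ?_
      rintro _ ⟨y, rfl⟩
      rw [mem_closedBall_zero_iff, pi_norm_le_iff_of_nonneg (norm_nonneg _)]
      exact fun k => g.norm_coe_le_norm _) (half_pos hδ)
    let g' : ι × Y → ℝ := fun z =>
      g z + ∑ k, if a k = z.1 then h' z.2 k - g (a k, z.2) else 0
    have hg'a : ∀ k y, g' (a k, y) = h' y k := by
      intro k y
      simp [g', a.injective.eq_iff]
    have hg'n : ∀ z : ι × Y, z.1 ∉ range a → g' z = g z := by
      intro z hz
      have : ∀ k, a k ≠ z.1 := fun k hk => hz ⟨k, hk⟩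
      simp [g', this]
    have hg'c : Continuous g' := by
      rw [continuous_prod_of_discrete_left]
      intro i
      refine Continuous.add (by fun_prop) (continuous_finsetSum _ fun k _ => ?_)
      by_cases hk : a k = i
      · simp only [hk, if_true]; fun_prop
      · simp only [hk, if_false]; fun_prop
    have hdist : ∀ z, dist (g' z) (g z) ≤ δ / 2 := by
      rintro ⟨i, y⟩
      by_cases hi : i ∈ range a
      · obtain ⟨k, rfl⟩ := hi
        rw [hg'a]
        exact (dist_le_pi_dist (h' y) (fun k => g (a k, y)) k).trans (hclose y).le
      · rw [hg'n _ hi, dist_self]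
        positivity
    let G : ι × Y →ᵇ ℝ := BoundedContinuousFunction.ofNormedAddCommGroup g' hg'c (‖g‖ + δ / 2)
      fun z => by
        have h1 := hdist z
        have h2 := g.norm_coe_le_norm z
        rw [dist_eq_norm] at h1
        have := norm_le_norm_add_norm_sub' (g' z) (g z)
        linarith
    refine ⟨G, ?_, ε / 2, half_pos hε, fun y => ?_⟩
    · refine lt_of_le_of_lt ?_ (half_lt_self hδ)
      exact (BoundedContinuousFunction.dist_le (half_pos hδ).le).2 hdist
    · by_contra! hcon
      have h1 : ‖h' y‖ ≤ ε / 2 := by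
        rw [pi_norm_le_iff_of_nonneg (half_pos hε).le]
        intro k
        have := (hcon k).le
        rwa [show G (a k, y) = h' y k from hg'a k y] at this
      linarith [hfar y]
  have : Countable (Fin (n + 1) ↪ ι) := DFunLike.coe_injective.countable
  obtain ⟨g, hg, hgr⟩ := (dense_iInter_of_isOpen hO hd).exists_mem_open Metric.isOpen_ball
    ⟨g₀, Metric.mem_ball_self hr⟩
  refine ⟨g, hgr, fun a y => ?_⟩
  obtain ⟨ε, hε, h⟩ := mem_iInter.1 hg a
  obtain ⟨k, hk⟩ := h y
  exact ⟨k, abs_pos.1 (hε.trans_le hk)⟩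

/-! ### Sets of dimension `≤ 0` and their countable unions. -/

/-- A subset whose points have small relatively clopen neighbourhoods has dimension `≤ 0`. -/
lemma coveringDimLE_zero_of_separated {X : Type*} [TopologicalSpace X]
    [SecondCountableTopology X] (D : Set X)
    (hD : ∀ x ∈ D, ∀ W, IsOpen W → x ∈ W → ∃ P Q : Set X, IsOpen P ∧ IsOpen Q ∧ Disjoint P Q ∧
      D ⊆ P ∪ Q ∧ x ∈ P ∧ P ⊆ W) : CoveringDimLE D 0 := by
  intro 𝒰 h𝒰
  have hcl : ∀ x : D, ∃ C : Set D, IsClopen C ∧ x ∈ C ∧ ∃ U ∈ 𝒰, C ⊆ U := by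
    intro x
    obtain ⟨U, hU, hx⟩ := (h𝒰.2 ▸ mem_univ x : x ∈ ⋃₀ 𝒰)
    obtain ⟨W, hW, rfl⟩ := isOpen_induced_iff.1 (h𝒰.1 U hU)
    obtain ⟨P, Q, hP, hQ, hdisj, hDPQ, hxP, hPW⟩ := hD x x.2 W hW hx
    refine ⟨Subtype.val ⁻¹' P, ⟨⟨?_⟩, hP.preimage continuous_subtype_val⟩, hxP, _, hU,
      preimage_mono hPW⟩
    have : (Subtype.val ⁻¹' P : Set D)ᶜ = Subtype.val ⁻¹' Q := by
      ext y
      constructor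
      · exact fun hy => (hDPQ y.2).resolve_left hy
      · exact fun hy hy' => disjoint_left.1 hdisj hy' hy
    rw [this]
    exact hQ.preimage continuous_subtype_val
  choose C hC hxC hCU using hcl
  rcases isEmpty_or_nonempty D with hE | hE
  · exact ⟨∅, ⟨by simp, by simp [eq_iff_true_of_subsingleton]⟩, by simp, by simp⟩
  obtain ⟨s, hs, hsc⟩ := TopologicalSpace.countable_cover_nhds
    (fun x => (hC x).isOpen.mem_nhds (hxC x))
  obtain ⟨f, hf⟩ := hs.exists_eq_range (by
    obtain ⟨x⟩ := hE
    obtain ⟨y, hy, -⟩ := mem_iUnion₂.1 (hsc ▸ mem_univ x : x ∈ ⋃ x ∈ s, C x)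
    exact ⟨y, hy⟩)
  have hopen : ∀ k, IsOpen (disjointed (C ∘ f) k) := by
    intro k
    rw [disjointed_eq_inter_compl]
    refine (hC _).isOpen.inter ((finite_Iio k).isOpen_biInter fun j _ => ?_)
    exact (hC _).compl.isOpen
  refine ⟨range (disjointed (C ∘ f)), ⟨?_, ?_⟩, ?_, fun x => ?_⟩
  · rintro _ ⟨k, rfl⟩
    exact hopen k
  · rw [sUnion_range, iUnion_disjointed, ← hsc, hf, biUnion_range]
    rfl
  · rintro _ ⟨k, rfl⟩
    obtain ⟨U, hU, h⟩ := hCU (f k)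
    exact ⟨U, hU, (disjointed_subset _ k).trans h⟩
  · simp only [Nat.cast_zero, zero_add]
    rw [encard_le_one_iff]
    rintro _ _ ⟨⟨j, rfl⟩, hj⟩ ⟨⟨k, rfl⟩, hk⟩
    by_contra hne
    exact disjoint_left.1 (disjoint_disjointed (C ∘ f) fun h => hne (congrArg _ h)) hj hk

/-- This ensures that a choice of open sets around all finite-dimensional sets covers `X`. -/
lemma coveringDimLE_zero_singleton {X : Type*} [TopologicalSpace X] (x : X) :
    CoveringDimLE ({x} : Set X) 0 := by
  intro 𝒰 h𝒰
  obtain ⟨U, hU, hx⟩ := (h𝒰.2 ▸ mem_univ (⟨x, rfl⟩ : ({x} : Set X)) : _ ∈ ⋃₀ 𝒰)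
  refine ⟨{U}, ⟨by simp, ?_⟩, fun V hV => ⟨U, hU, hV.le⟩, fun y => ?_⟩
  · exact eq_univ_of_forall fun y => ⟨U, rfl, Subsingleton.elim (⟨x, rfl⟩ : ({x} : Set X)) y ▸ hx⟩
  · refine (encard_le_encard (t := {U}) fun V hV => hV.1).trans (by simp)

/-- `G` is covered by countably many sets of dimension `≤ 0`. -/
def CountablyZeroDim {X : Type*} [TopologicalSpace X] (G : Set X) : Prop :=
  ∃ 𝒟 : Set (Set X), 𝒟.Countable ∧ (∀ D ∈ 𝒟, CoveringDimLE D 0) ∧ G ⊆ ⋃₀ 𝒟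

lemma CountablyZeroDim.iUnion {X κ : Type*} [TopologicalSpace X] [Countable κ] {G : κ → Set X}
    (hG : ∀ k, CountablyZeroDim (G k)) : CountablyZeroDim (⋃ k, G k) := by
  choose 𝒟 hc hd hs using hG
  refine ⟨⋃ k, 𝒟 k, countable_iUnion hc, fun D hD => ?_, ?_⟩
  · obtain ⟨k, hk⟩ := mem_iUnion.1 hD
    exact hd k D hk
  · exact iUnion_subset fun k => (hs k).trans (sUnion_mono (subset_iUnion 𝒟 k))

lemma isCountableDim_of_countablyZeroDim {X : Type*} [TopologicalSpace X]
    (h : CountablyZeroDim (univ : Set X)) : IsCountableDim X := by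
  obtain ⟨𝒟, hc, hd, hs⟩ := h
  refine ⟨{D ∈ 𝒟 | D.Nonempty}, hc.mono (sep_subset _ _), fun D hD => ⟨hD.2, hd D hD.1⟩, ?_⟩
  refine eq_univ_of_forall fun x => ?_
  obtain ⟨D, hD, hx⟩ := hs (mem_univ x)
  exact ⟨D, ⟨hD, x, hx⟩, hx⟩

/-! ### The `Gδ` enlargement of a finite-dimensional set. -/

/-- Disjoint relatively open subsets given by the sign of a continuous function extend to disjoint
open sets. -/
lemma separatedNhds_sign {X : Type*} [TopologicalSpace X] [CompletelyNormalSpace X] {A : Set X}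
    {f : A → ℝ} (hf : Continuous f) :
    SeparatedNhds (Subtype.val '' {y | f y < 0}) (Subtype.val '' {y | 0 < f y}) := by
  rw [separatedNhds_iff_disjoint]
  refine completely_normal ?_ ?_
  · rw [disjoint_left]
    rintro _ hz ⟨y, hy, rfl⟩
    rw [← closure_subtype] at hz
    have : y ∈ {y | f y ≤ 0} :=
      closure_minimal (fun z (hz : f z < 0) => hz.le) (isClosed_le hf continuous_const) hz
    exact (show 0 < f y from hy).not_ge this
  · rw [disjoint_right]
    rintro _ hz ⟨y, hy, rfl⟩
    rw [← closure_subtype] at hz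
    have : y ∈ {y | 0 ≤ f y} :=
      closure_minimal (fun z (hz : 0 < f z) => hz.le) (isClosed_le continuous_const hf) hz
    exact (show f y < 0 from hy).not_ge this

/-- In a separable metric space, there is a countable family of disjoint pairs of open sets, whose
first members contain and approximate balls, such that each point of a given `n`-dimensional set
lies outside at most `n` of the pairs. -/
lemma CoveringDimLE.exists_separating_family {X : Type*} [MetricSpace X] (c : ℕ → X) {A : Set X}
    {n : ℕ} (hA : CoveringDimLE A n) :
    ∃ P Q : ℕ × ℕ → Set X, (∀ i, IsOpen (P i)) ∧ (∀ i, IsOpen (Q i)) ∧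
      (∀ i, Disjoint (P i) (Q i)) ∧
      (∀ i, Metric.ball (c i.1) (1 / (i.2 + 1)) ⊆ P i) ∧
      (∀ i, P i ⊆ Metric.ball (c i.1) (2 * (1 / (i.2 + 1)))) ∧
      ∀ a : Fin (n + 1) ↪ ℕ × ℕ, A ⊆ ⋃ k, (P (a k) ∪ Q (a k)) := by
  -- `φ` is `-1` within the inner radius and `1` beyond the outer one, so a perturbation by less
  -- than `1` keeps the signs there.
  let φ : (ℕ × ℕ) × A → ℝ := fun z =>
    max (-1) (min 1 (2 * (z.1.2 + 1) * dist (z.2 : X) (c z.1.1) - 3))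
  have hφ : Continuous φ := by
    rw [continuous_prod_of_discrete_left]
    intro i
    dsimp only [φ]
    fun_prop
  have hφ1 : ∀ z, ‖φ z‖ ≤ 1 := fun z =>
    abs_le.2 ⟨le_max_left _ _, max_le (by norm_num) (min_le_left _ _)⟩
  obtain ⟨g, hg, hne⟩ := hA.exists_near_family
    (BoundedContinuousFunction.ofNormedAddCommGroup φ hφ 1 hφ1) one_pos
  have hgφ : ∀ z, |g z - φ z| < 1 := fun z =>
    (BoundedContinuousFunction.dist_coe_le_dist z).trans_lt hg
  have hneg : ∀ i (y : A), dist (y : X) (c i.1) ≤ 1 / (i.2 + 1) → g (i, y) < 0 := by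
    intro i y hy
    rw [le_div_iff₀ (by positivity)] at hy
    have h1 : φ (i, y) = -1 := max_eq_left ((min_le_right _ _).trans (by
      dsimp only; nlinarith))
    have := (abs_lt.1 (hgφ (i, y))).2
    linarith
  have hpos : ∀ i (y : A), 2 * (1 / (i.2 + 1)) ≤ dist (y : X) (c i.1) → 0 < g (i, y) := by
    intro i y hy
    rw [← mul_div_assoc, mul_one, div_le_iff₀ (by positivity)] at hy
    have h1 : (1 : ℝ) ≤ φ (i, y) := le_max_of_le_right (le_min le_rfl (by
      dsimp only; nlinarith))
    have := (abs_lt.1 (hgφ (i, y))).1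
    linarith
  have hsep := fun i => separatedNhds_sign (f := fun y : A => g (i, y)) (by fun_prop)
  choose E E' hE hE' hEs hEs' hEE using hsep
  -- The signs control `E` and `E'` only on `A`; these corrections impose the ball inclusions in all
  -- of `X`.
  refine ⟨fun i => E i ∩ Metric.ball (c i.1) (2 * (1 / (i.2 + 1))) ∪
      Metric.ball (c i.1) (1 / (i.2 + 1)),
    fun i => E' i \ Metric.closedBall (c i.1) (1 / (i.2 + 1)),
    fun i => ((hE i).inter Metric.isOpen_ball).union Metric.isOpen_ball,
    fun i => (hE' i).sdiff Metric.isClosed_closedBall, fun i => ?_, fun i => subset_union_right,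
    fun i => ?_, fun a x hx => ?_⟩
  · rw [disjoint_left]
    rintro x (⟨hx, -⟩ | hx) ⟨hx', hx2⟩
    · exact disjoint_left.1 (hEE i) hx hx'
    · exact hx2 (Metric.ball_subset_closedBall hx)
  · refine union_subset inter_subset_right (Metric.ball_subset_ball ?_)
    have : (0 : ℝ) < 1 / (i.2 + 1) := by positivity
    linarith
  · obtain ⟨k, hk⟩ := hne a ⟨x, hx⟩
    refine mem_iUnion.2 ⟨k, ?_⟩
    rcases lt_or_gt_of_ne hk with h | h
    · refine Or.inl (Or.inl ⟨hEs _ ⟨⟨x, hx⟩, h, rfl⟩, ?_⟩)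
      by_contra hcon
      exact lt_asymm h (hpos (a k) ⟨x, hx⟩ (not_lt.1 hcon))
    · refine Or.inr ⟨hEs' _ ⟨⟨x, hx⟩, h, rfl⟩, fun hcon => ?_⟩
      exact lt_asymm h (hneg (a k) ⟨x, hx⟩ hcon)

/-- In a separable metrizable space, a set of finite dimension is contained in a `Gδ` set which is
a countable union of sets of dimension `≤ 0`. -/
lemma IsFiniteDim.exists_countablyZeroDim_superset {X : Type*} [TopologicalSpace X]
    [TopologicalSpace.MetrizableSpace X] [TopologicalSpace.SeparableSpace X] {A : Set X}
    (hA : IsFiniteDim A) :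
    ∃ 𝒰 : Set (Set X), 𝒰.Countable ∧ (∀ U ∈ 𝒰, IsOpen U ∧ A ⊆ U) ∧ CountablyZeroDim (⋂₀ 𝒰) := by
  classical
  let := TopologicalSpace.metrizableSpaceMetric X
  have := UniformSpace.secondCountable_of_separable X
  obtain ⟨n, hn⟩ := hA
  rcases isEmpty_or_nonempty X with hX | hX
  · exact ⟨∅, countable_empty, by simp, ∅, countable_empty, by simp, fun x => hX.elim x⟩
  obtain ⟨P, Q, hP, hQ, hPQ, hbP, hPb, hcov⟩ :=
    hn.exists_separating_family (TopologicalSpace.denseSeq X)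
  have : Countable (Fin (n + 1) ↪ ℕ × ℕ) := DFunLike.coe_injective.countable
  refine ⟨range fun a : Fin (n + 1) ↪ ℕ × ℕ => ⋃ k, (P (a k) ∪ Q (a k)), countable_range _, ?_,
    range fun F : Finset (ℕ × ℕ) => {x | ∀ i, i ∉ F → x ∈ P i ∪ Q i}, countable_range _, ?_, ?_⟩
  · rintro _ ⟨a, rfl⟩
    exact ⟨isOpen_iUnion fun k => (hP _).union (hQ _), hcov a⟩
  · rintro _ ⟨F, rfl⟩
    refine coveringDimLE_zero_of_separated _ fun x hx W hW hxW => ?_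
    obtain ⟨δ, hδ, hball⟩ := Metric.isOpen_iff.1 hW x hxW
    obtain ⟨m₀, hm₀⟩ := exists_nat_one_div_lt (show (0 : ℝ) < δ / 3 by positivity)
    -- Exceeding every second coordinate in `F` keeps `(k, m)` out of `F` for whichever `k` is
    -- chosen.
    let m := max m₀ (F.sup Prod.snd + 1)
    have hm : 1 / ((m : ℝ) + 1) < δ / 3 := by
      refine lt_of_le_of_lt (one_div_le_one_div_of_le (by positivity) ?_) hm₀
      have : (m₀ : ℝ) ≤ m := by exact_mod_cast le_max_left _ _
      linarith
    obtain ⟨k, hk⟩ := (TopologicalSpace.denseRange_denseSeq X).exists_dist_lt x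
      (show (0 : ℝ) < 1 / ((m : ℝ) + 1) by positivity)
    have hi : (k, m) ∉ F := by
      intro h
      have h1 : m ≤ F.sup Prod.snd := Finset.le_sup (f := Prod.snd) h
      have h2 : F.sup Prod.snd + 1 ≤ m := le_max_right _ _
      omega
    refine ⟨P (k, m), Q (k, m), hP _, hQ _, hPQ _, fun y hy => hy _ hi, hbP (k, m) hk,
      (hPb _).trans (Subset.trans ?_ hball)⟩
    refine Metric.ball_subset_ball' ?_
    rw [dist_comm]
    dsimp only
    linarith
  · intro x hx
    have hfin : {i | x ∉ P i ∪ Q i}.Finite := by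
      by_contra hinf
      let b := Set.Infinite.natEmbedding _ hinf
      let a : Fin (n + 1) ↪ ℕ × ℕ :=
        (Fin.valEmbedding.trans b).trans (Function.Embedding.subtype _)
      obtain ⟨k, hk⟩ := mem_iUnion.1 (hx _ ⟨a, rfl⟩)
      exact (b k).2 hk
    refine ⟨_, ⟨hfin.toFinset, rfl⟩, fun i hi => ?_⟩
    simpa [or_iff_not_imp_left] using hi

/-! ### The game. -/

/-- Playing by a legal strategy `F`, after any position TWO is bound to a response containing a
fixed finite-dimensional set: every open `U ≠ X` around it is a possible response. -/
lemma exists_finiteDim_of_legal {X : Type*} [TopologicalSpace X] {F : List (Set (Set X)) → Set X}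
    (hF : ∀ (σ : List (fdCovers X)) (O : fdCovers X),
      F ((σ ++ [O]).map Subtype.val) ∈ (O : Set (Set X))) (σ : List (fdCovers X)) :
    ∃ T : Set X, IsFiniteDim T ∧ ∀ U, IsOpen U → T ⊆ U → U ≠ univ →
      ∃ O : fdCovers X, F ((σ ++ [O]).map Subtype.val) = U := by
  by_contra! hcon
  choose! U hUo hTU hUne hUF using hcon
  -- If around each `T` some `U T` is never a response, these sets form a legal move, yet `F` must
  -- answer it with one of them.
  have hO : {V | ∃ T : Set X, IsFiniteDim T ∧ V = U T} ∈ fdCovers X := by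
    refine ⟨⟨?_, ?_⟩, ?_, fun T hT => ⟨U T, ⟨T, hT, rfl⟩, hTU T hT⟩⟩
    · rintro _ ⟨T, hT, rfl⟩
      exact hUo T hT
    · refine eq_univ_of_forall fun x => ?_
      have hx : IsFiniteDim ({x} : Set X) := ⟨0, coveringDimLE_zero_singleton x⟩
      exact ⟨U {x}, ⟨_, hx, rfl⟩, hTU _ hx rfl⟩
    · rintro ⟨T, hT, h⟩
      exact hUne T hT h.symm
  obtain ⟨T, hT, h⟩ := hF σ ⟨_, hO⟩
  exact hUF T hT ⟨_, hO⟩ h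

lemma map_getD_range_length {α : Type*} (σ : List α) (d : α) :
    (List.range σ.length).map (fun i => σ.getD i d) = σ := by
  refine List.ext_getElem (by simp) fun i h1 h2 => ?_
  simp [List.getElem?_eq_getElem h2]

lemma isCountableDim_of_twoHasWinningStrategy {X : Type*} [TopologicalSpace X]
    [TopologicalSpace.MetrizableSpace X] [TopologicalSpace.SeparableSpace X]
    (h : TwoHasWinningStrategy (fdCovers X) (openCovers X)) : IsCountableDim X := by
  obtain ⟨F, hF⟩ := h
  by_contra hX
  have hlegal : ∀ (σ : List (fdCovers X)) (O : fdCovers X),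
      F ((σ ++ [O]).map Subtype.val) ∈ (O : Set (Set X)) := by
    intro σ O
    -- Legality is assumed along infinite plays, so the position is continued by repeating `O`.
    let p : ℕ → fdCovers X := fun i => (σ ++ [O]).getD i O
    have h1 := (hF (fun i => (p i : Set (Set X))) fun i => (p i).2).1 σ.length
    have h2 : (List.range (σ.length + 1)).map (fun i => (p i : Set (Set X))) =
        (σ ++ [O]).map Subtype.val := by
      have := map_getD_range_length (σ ++ [O]) O
      rw [List.length_append, List.length_singleton] at this
      conv_rhs => rw [← this]
      simp [p]
    rw [response, h2] at h1
    simpa [p] using h1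
  have hstep : ∀ σ : List (fdCovers X), ∃ (O : ℕ → fdCovers X) (G : Set X),
      CountablyZeroDim G ∧ ∀ x ∉ G, ∃ k, x ∉ F ((σ ++ [O k]).map Subtype.val) := by
    intro σ
    obtain ⟨T, hT, hU⟩ := exists_finiteDim_of_legal hlegal σ
    obtain ⟨𝒰, hc, hTU, hG⟩ := hT.exists_countablyZeroDim_superset
    have hne : ∃ U ∈ 𝒰, U ≠ univ := by
      by_contra! hcon
      rw [sInter_eq_univ.2 hcon] at hG
      exact hX (isCountableDim_of_countablyZeroDim hG)
    obtain ⟨V, hV⟩ := (hc.mono (sep_subset 𝒰 (· ≠ univ))).exists_eq_range hne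
    have hV' : ∀ k, V k ∈ 𝒰 ∧ V k ≠ univ := fun k => (hV ▸ mem_range_self k : V k ∈ {U ∈ 𝒰 | U ≠ univ})
    choose O hO using fun k => hU (V k) (hTU _ (hV' k).1).1 (hTU _ (hV' k).1).2 (hV' k).2
    refine ⟨O, _, hG, fun x hx => ?_⟩
    obtain ⟨U, hU𝒰, hxU⟩ : ∃ U ∈ 𝒰, x ∉ U := by simpa using hx
    obtain ⟨k, rfl⟩ : U ∈ range V :=
      hV ▸ (⟨hU𝒰, fun h => hxU (h ▸ mem_univ x)⟩ : U ∈ {U ∈ 𝒰 | U ≠ univ})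
    exact ⟨k, by rwa [hO]⟩
  choose O G hG hOG using hstep
  -- The head of `τ` is the latest choice, whereas positions grow at the end.
  let pos : List ℕ → List (fdCovers X) := fun τ =>
    τ.rec [] fun k _ σ => σ ++ [O σ k]
  obtain ⟨x, hx⟩ : ∃ x, ∀ τ, x ∉ G (pos τ) := by
    by_contra! hcon
    refine hX (isCountableDim_of_countablyZeroDim ?_)
    rw [← eq_univ_of_forall fun x => mem_iUnion.2 (hcon x)]
    exact CountablyZeroDim.iUnion fun τ => hG _
  choose k hk using fun τ => hOG (pos τ) x (hx τ)
  let τ : ℕ → List ℕ := fun n => n.rec [] fun _ t => k t :: t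
  let p : ℕ → Set (Set X) := fun n => O (pos (τ n)) (k (τ n))
  have hpos : ∀ n, (List.range n).map p = (pos (τ n)).map Subtype.val := by
    intro n
    induction n with
    | zero => rfl
    | succ n ih =>
      rw [List.range_succ, List.map_append, ih]
      change _ = (pos (τ n) ++ [O (pos (τ n)) (k (τ n))]).map Subtype.val
      simp [p]
  have hcover := (hF p fun n => (O (pos (τ n)) (k (τ n))).2).2.2
  obtain ⟨_, ⟨n, rfl⟩, hxn⟩ := (hcover ▸ mem_univ x : x ∈ ⋃₀ range (response F p))
  rw [response, hpos] at hxn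
  exact hk (τ n) hxn

lemma twoHasWinningStrategy_of_isCountableDim {X : Type*} [TopologicalSpace X]
    (h : IsCountableDim X) : TwoHasWinningStrategy (fdCovers X) (openCovers X) := by
  classical
  obtain ⟨𝒮, hc, hz, hcov⟩ := h
  rcases 𝒮.eq_empty_or_nonempty with rfl | hne
  · have hX : IsEmpty X := ⟨fun x =>
      (sUnion_empty.symm.trans hcov ▸ mem_univ x : x ∈ (∅ : Set X))⟩
    refine ⟨fun _ => ∅, fun O hO => ?_⟩
    -- In an empty space the only subset is `univ`, so ONE has no legal move.
    obtain ⟨U, hU, -⟩ := (hO 0).2.2 ∅ ⟨0, fun 𝒰 _ => ⟨∅, ⟨by simp, by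
      ext x; exact hX.elim x⟩, by simp, by simp⟩⟩
    exact absurd (Subsingleton.elim U univ ▸ hU) (hO 0).2.1
  obtain ⟨A, rfl⟩ := hc.exists_eq_range hne
  have hA : ∀ n, IsFiniteDim (A n) := fun n => ⟨0, (hz _ (mem_range_self n)).2⟩
  -- In inning `n` the list has `n + 1` entries, so `A n` is used; both defaults `∅` are never
  -- reached in legal play.
  let F : List (Set (Set X)) → Set X := fun σ =>
    if h : ∃ U ∈ σ.getLastD ∅, A (σ.length - 1) ⊆ U then h.choose else ∅
  have hF : ∀ O : ℕ → Set (Set X), (∀ n, O n ∈ fdCovers X) → ∀ n,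
      response F O n ∈ O n ∧ A n ⊆ response F O n := by
    intro O hO n
    have h : ∃ U ∈ ((List.range (n + 1)).map O).getLastD ∅,
        A (((List.range (n + 1)).map O).length - 1) ⊆ U := by
      simpa [List.range_succ] using (hO n).2.2 _ (hA n)
    have h1 : response F O n = h.choose := dif_pos h
    have h2 := h.choose_spec
    rw [← h1] at h2
    simpa [List.range_succ] using h2
  refine ⟨F, fun O hO => ⟨fun n => (hF O hO n).1, ?_, ?_⟩⟩
  · rintro _ ⟨n, rfl⟩
    exact (hO n).1.1 _ (hF O hO n).1
  · refine eq_univ_of_forall fun x => ?_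
    obtain ⟨_, ⟨n, rfl⟩, hx⟩ := (hcov ▸ mem_univ x : x ∈ ⋃₀ range A)
    exact ⟨_, ⟨n, rfl⟩, (hF O hO n).2 hx⟩

end DimGame

theorem corollary3p4 (X : Type*) [TopologicalSpace X] [TopologicalSpace.MetrizableSpace X]
    [TopologicalSpace.SeparableSpace X] :
    DimGame.IsCountableDim X ↔
      DimGame.TwoHasWinningStrategy (DimGame.fdCovers X) (DimGame.openCovers X) :=
  ⟨DimGame.twoHasWinningStrategy_of_isCountableDim,
    DimGame.isCountableDim_of_twoHasWinningStrategy⟩
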